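/- Let $V$ be a nonempty finite set, let $P=(P_{ij})_{i,j\in V}$ be an irreducible row-stochastic matrix (reversibility is not assumed), and let $\lambda>0$. Let $(X_t)_{t\ge 0}$ be a $V$-valued stochastic process on a probability space, with arbitrary initial law and natural filtration $\mathcal F_t=\sigma(X_0,\dots,X_t)$. For $t\ge 0$ and $i,j\in V$ put \[ L_t(i)=\sum_{s=0}^{t-1}\mathbf 1\{X_s=i\},\qquad N_t(i,j)=\sum_{s=0}^{t-1}\mathbf 1\{X_s=i,\ X_{s+1}=j\},\qquad \epsilon_t(i,j)=N_t(i,j)-L_t(i)P_{ij}, \] and assume that the process follows the true self-avoiding walk rule: for all $t\ge 0$ and $j\in V$, almost surely, \[ \mathbb P(X_{t+1}=j\mid\mathcal F_t)=Q_t(X_t,j),\qquad Q_t(i,j)=\frac{P_{ij}\,e^{-\lambda\epsilon_t(i,j)}}{\sum_{k\in V}P_{ik}\,e^{-\lambda\epsilon_t(i,k)}}. \] Then, almost surely, every state $i\in V$ is visited infinitely often, that is, $X_t=i$ for infinitely many $t$; and every directed edge $(i,j)$ with $P_{ij}>0$ is traversed infinitely often, that is, $X_t=i$ and $X_{t+1}=j$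 for infinitely many $t$. -/

import Mathlib

open MeasureTheory

noncomputable section

namespace TSAW

variable {V : Type*} [DecidableEq V]

/-- Departure count: the number of times `s ∈ {0, …, t - 1}` at which the trajectory `x` is
at `i`. -/
def departureCount (x : ℕ → V) (t : ℕ) (i : V) : ℕ :=
  ∑ s ∈ Finset.range t, if x s = i then 1 else 0

/-- Directed edge count: the number of times `s ∈ {0, …, t - 1}` at which the trajectory `x`
steps from `i` to `j`. -/
def edgeCount (x : ℕ → V) (t : ℕ) (i j : V) : ℕ :=
  ∑ s ∈ Finset.range t, if x s = i ∧ x (s + 1) = j then 1 else 0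

/-- Edge discrepancy `ε_t(i, j) = N_t(i, j) - L_t(i) P_{ij}`. -/
def edgeDiscrepancy (P : Matrix V V ℝ) (x : ℕ → V) (t : ℕ) (i j : V) : ℝ :=
  (edgeCount x t i j : ℝ) - (departureCount x t i : ℝ) * P i j

/-- The adaptive transition probability
`Q_t(i, j) = P_{ij} exp(-λ ε_t(i, j)) / ∑_k P_{ik} exp(-λ ε_t(i, k))`,
which depends on the trajectory only through its positions at times `0, …, t`. -/
def transition [Fintype V] (P : Matrix V V ℝ) (lam : ℝ) (x : ℕ → V) (t : ℕ) (i j : V) : ℝ :=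
  P i j * Real.exp (-lam * edgeDiscrepancy P x t i j) /
    ∑ k, P i k * Real.exp (-lam * edgeDiscrepancy P x t i k)

/-- The natural filtration `F_t = σ(X_0, …, X_t)` of a `V`-valued process. -/
abbrev past {Ω V : Type*} [mV : MeasurableSpace V] (X : ℕ → Ω → V) (t : ℕ) : MeasurableSpace Ω :=
  ⨆ s ≤ t, MeasurableSpace.comap (X s) mV

/-- The rule `ℙ(X_{t+1} = j ∣ F_t, X_t = i) = Q_t(i, j)`: for every time `t` and every state `j`,
the conditional probability of `X_{t+1} = j` given `F_t` is almost surely `Q_t(X_t, j)`. The law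
of `X_0` is arbitrary. -/
def IsTrueSelfAvoidingWalk {Ω : Type*} [MeasurableSpace Ω] [Fintype V] [MeasurableSpace V]
    (P : Matrix V V ℝ) (lam : ℝ) (μ : Measure Ω) (X : ℕ → Ω → V) : Prop :=
  ∀ (t : ℕ) (j : V),
    μ[Set.indicator {ω | X (t + 1) ω = j} (fun _ => (1 : ℝ)) | past X t]
      =ᵐ[μ] fun ω => transition P lam (fun s => X s ω) t (X t ω) j

end TSAW

end

namespace TSAW

open Filter Topology

variable {V : Type*} [DecidableEq V]

/-! Suppose `i` is visited infinitely often but `(i, k)`, with `P i k > 0`, is not used infinitely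
often. Then the discrepancy of `(i, k)` tends to `-∞`, and by Lévy's Borel–Cantelli lemma its
probabilities are summable over the visits to `i`. They dominate, up to a constant, those of any
edge `(i, l)` of larger discrepancy, so such edges are used only finitely often at those times
(`ae_infinite_edge`). Hence every discrepancy out of `i` is bounded above, which contradicts their
zero sum (`infinite_edge_of_infinite_visits`). Irreducibility then spreads recurrence from one state
to all. -/

lemma departureCount_succ (x : ℕ → V) (t : ℕ) (i : V) :
    departureCount x (t + 1) i = departureCount x t i + if x t = i then 1 else 0 :=
  Finset.sum_range_succ _ _

lemma edgeCount_succ (x : ℕ → V) (t : ℕ) (i j : V) :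
    edgeCount x (t + 1) i j = edgeCount x t i j + if x t = i ∧ x (t + 1) = j then 1 else 0 :=
  Finset.sum_range_succ _ _

lemma sum_edgeCount [Fintype V] (x : ℕ → V) (t : ℕ) (i : V) :
    ∑ j, edgeCount x t i j = departureCount x t i := by
  simp only [edgeCount, departureCount]
  rw [Finset.sum_comm]
  refine Finset.sum_congr rfl fun s _ => ?_
  by_cases h : x s = i <;> simp [h]

/-- The edge discrepancies out of a state sum to zero. -/
lemma sum_edgeDiscrepancy [Fintype V] {P : Matrix V V ℝ} {i : V} (hP : ∑ j, P i j = 1)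
    (x : ℕ → V) (t : ℕ) : ∑ j, edgeDiscrepancy P x t i j = 0 := by
  simp only [edgeDiscrepancy, Finset.sum_sub_distrib, ← Finset.mul_sum, hP, mul_one,
    ← sum_edgeCount x t i, Nat.cast_sum, sub_self]

lemma monotone_departureCount (x : ℕ → V) (i : V) : Monotone fun t => departureCount x t i :=
  monotone_nat_of_le_succ fun t => by simp [departureCount_succ]

lemma tendsto_departureCount {x : ℕ → V} {i : V} (h : {t | x t = i}.Infinite) :
    Tendsto (fun t => departureCount x t i) atTop atTop := by
  refine tendsto_atTop_atTop_of_monotone (monotone_departureCount x i) fun b => ?_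
  induction b with
  | zero => exact ⟨0, Nat.zero_le _⟩
  | succ b ih =>
    obtain ⟨T, hT⟩ := ih
    obtain ⟨t, ht, hlt⟩ := h.exists_gt T
    refine ⟨t + 1, ?_⟩
    have := monotone_departureCount x i hlt.le
    simp only [Set.mem_ofPred_eq] at ht this
    simp only [departureCount_succ, ht, if_true]
    omega

lemma exists_edgeCount_le {x : ℕ → V} {i j : V} (h : {t | x t = i ∧ x (t + 1) = j}.Finite) :
    ∃ C, ∀ t, edgeCount x t i j ≤ C := by
  refine ⟨h.toFinset.card, fun t => ?_⟩
  rw [edgeCount, ← Finset.card_filter]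
  exact Finset.card_le_card fun s hs => by simpa using (Finset.mem_filter.1 hs).2

/-- If an edge out of `i` is eventually only used when its discrepancy is at most `C`, then its
discrepancy is bounded above. -/
lemma exists_edgeDiscrepancy_le {P : Matrix V V ℝ} {x : ℕ → V} {i j : V} (hP : 0 ≤ P i j) {C : ℝ}
    {T : ℕ} (h : ∀ t ≥ T, x t = i → x (t + 1) = j → edgeDiscrepancy P x t i j ≤ C) :
    ∃ D, ∀ t ≥ T, edgeDiscrepancy P x t i j ≤ D := by
  -- Only a traversal can raise the discrepancy, by `1 - P i j ≤ 1`, and it starts from at most `C`.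
  refine ⟨max (edgeDiscrepancy P x T i j) (C + 1), fun t ht => ?_⟩
  induction t, ht using Nat.le_induction with
  | base => exact le_max_left _ _
  | succ t ht ih =>
    have hs : edgeDiscrepancy P x (t + 1) i j = edgeDiscrepancy P x t i j +
        ((if x t = i ∧ x (t + 1) = j then 1 else 0) - (if x t = i then 1 else 0) * P i j) := by
      simp only [edgeDiscrepancy, edgeCount_succ, departureCount_succ]
      push_cast
      ring
    by_cases hi : x t = i
    · by_cases hj : x (t + 1) = j
      · refine le_trans ?_ (le_max_right _ _)
        have := h t ht hi hj
        simp only [hs, hi, hj, and_self, if_true]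
        linarith
      · refine le_trans ?_ ih
        simp only [hs, hi, hj, and_false, if_true, if_false]
        linarith
    · simpa [hs, hi] using ih

/-- If `i` is visited infinitely often and, compared with the edge `(i, k)`, no edge out of `i` of
larger discrepancy is used infinitely often unless `(i, k)` is, then `(i, k)` is used infinitely
often. -/
lemma infinite_edge_of_infinite_visits [Fintype V] {P : Matrix V V ℝ} {x : ℕ → V} {i k : V}
    (hP : ∀ j, 0 ≤ P i j) (hsum : ∑ j, P i j = 1) (hk : 0 < P i k)
    (hi : {t | x t = i}.Infinite)
    (h : ∀ l, {t | (x t = i ∧ edgeDiscrepancy P x t i k ≤ edgeDiscrepancy P x t i l) ∧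
        x (t + 1) = l}.Infinite → {t | x t = i ∧ x (t + 1) = k}.Infinite) :
    {t | x t = i ∧ x (t + 1) = k}.Infinite := by
  by_contra hfin
  obtain ⟨C, hC⟩ := exists_edgeCount_le (Set.not_infinite.1 hfin)
  have hCle : ∀ t, edgeDiscrepancy P x t i k ≤ C - departureCount x t i * P i k := fun t =>
    sub_le_sub_right (Nat.cast_le.2 (hC t)) _
  -- The discrepancy of `(i, k)` never exceeds `C`, so a traversal of `(i, l)` above level `C` is of
  -- the kind that occurs finitely often.
  have hbound : ∀ l, ∃ D, ∀ᶠ t in atTop, edgeDiscrepancy P x t i l ≤ D := fun l => by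
    obtain ⟨T, hT⟩ := (Set.not_infinite.1 fun hl => hfin (h l hl)).bddAbove
    obtain ⟨D, hD⟩ := exists_edgeDiscrepancy_le (T := T + 1) (C := C) (hP l)
      fun t ht hti htl => by
        by_contra! hlt
        have hle : edgeDiscrepancy P x t i k ≤ C :=
          (hCle t).trans (sub_le_self _ (by positivity))
        have : t ≤ T := hT ⟨⟨hti, hle.trans hlt.le⟩, htl⟩
        omega
    exact ⟨D, eventually_atTop.2 ⟨T + 1, hD⟩⟩
  choose D hD using hbound
  have hbot : Tendsto (fun t => edgeDiscrepancy P x t i k) atTop atBot := by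
    refine tendsto_atBot_mono hCle (tendsto_atBot_add_const_left _ (C : ℝ) ?_)
    exact tendsto_neg_atTop_atBot.comp
      ((tendsto_natCast_atTop_atTop.comp (tendsto_departureCount hi)).atTop_mul_const hk)
  obtain ⟨t, ht, htk⟩ := ((eventually_all.2 hD).and
    (hbot.eventually_lt_atBot (-∑ l ∈ Finset.univ.erase k, D l))).exists
  have h0 := sum_edgeDiscrepancy hsum x t
  rw [← Finset.add_sum_erase _ _ (Finset.mem_univ k)] at h0
  have := Finset.sum_le_sum fun l (_ : l ∈ Finset.univ.erase k) => ht l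
  linarith

/-- Ratio bound: an edge with larger discrepancy is less likely, relative to `P`. -/
lemma transition_le_mul_transition [Fintype V] {P : Matrix V V ℝ} {lam : ℝ} (hlam : 0 ≤ lam)
    {x : ℕ → V} {t : ℕ} {i k l : V} (hP : ∀ j, 0 ≤ P i j) (hk : 0 < P i k)
    (h : edgeDiscrepancy P x t i k ≤ edgeDiscrepancy P x t i l) :
    transition P lam x t i l ≤ P i l / P i k * transition P lam x t i k := by
  have hZ : 0 ≤ ∑ j, P i j * Real.exp (-lam * edgeDiscrepancy P x t i j) :=
    Finset.sum_nonneg fun j _ => mul_nonneg (hP j) (Real.exp_pos _).le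
  have hexp : Real.exp (-lam * edgeDiscrepancy P x t i l) ≤
      Real.exp (-lam * edgeDiscrepancy P x t i k) :=
    Real.exp_le_exp.2 (by nlinarith)
  calc transition P lam x t i l
      ≤ P i l * Real.exp (-lam * edgeDiscrepancy P x t i k) /
          ∑ j, P i j * Real.exp (-lam * edgeDiscrepancy P x t i j) :=
        div_le_div_of_nonneg_right (mul_le_mul_of_nonneg_left hexp (hP l)) hZ
    _ = P i l / P i k * transition P lam x t i k := by
        rw [transition, ← mul_div_assoc, ← mul_assoc, div_mul_cancel₀ _ hk.ne']

lemma transition_nonneg [Fintype V] {P : Matrix V V ℝ} {lam : ℝ} {x : ℕ → V} {t : ℕ} {i : V}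
    (hP : ∀ j, 0 ≤ P i j) (k : V) : 0 ≤ transition P lam x t i k :=
  div_nonneg (mul_nonneg (hP k) (Real.exp_pos _).le)
    (Finset.sum_nonneg fun j _ => mul_nonneg (hP j) (Real.exp_pos _).le)

section Walk

variable {Ω : Type*} [MeasurableSpace V]

lemma measurable_past {V : Type*} [MeasurableSpace V] (X : ℕ → Ω → V) {s t : ℕ} (h : s ≤ t) : Measurable[past X t] (X s) :=
  Measurable.mono (comap_measurable (X s)) (le_iSup₂_of_le s h le_rfl) le_rfl

lemma measurable_edgeDiscrepancy [MeasurableSingletonClass V] (P : Matrix V V ℝ) (X : ℕ → Ω → V)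
    (t : ℕ) (i j : V) :
    Measurable[past X t] fun ω => edgeDiscrepancy P (fun s => X s ω) t i j := by
  let : MeasurableSpace Ω := past X t
  have hX : ∀ s ≤ t, ∀ a, MeasurableSet {ω | X s ω = a} := fun s hs a =>
    measurable_past X hs (measurableSet_singleton a)
  simp only [edgeDiscrepancy, edgeCount, departureCount, Nat.cast_sum]
  refine Measurable.sub (Finset.measurable_fun_sum _ fun s hs => ?_)
    ((Finset.measurable_fun_sum _ fun s hs => ?_).mul_const _)
  · have hs := Finset.mem_range.1 hs
    exact (measurable_from_top (f := fun n : ℕ => (n : ℝ))).comp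
      (Measurable.ite ((hX s hs.le i).inter (hX (s + 1) hs j)) measurable_const measurable_const)
  · have hs := Finset.mem_range.1 hs
    exact (measurable_from_top (f := fun n : ℕ => (n : ℝ))).comp
      (Measurable.ite (hX s hs.le i) measurable_const measurable_const)

/-- Lévy's conditional Borel–Cantelli lemma for steps of the walk: steps to `l` at times of the
predictable events `B t` occur infinitely often exactly when their conditional probabilities
have infinite sum. -/
lemma ae_infinite_step_iff [Fintype V] [MeasurableSingletonClass V] {m : MeasurableSpace Ω}
    {P : Matrix V V ℝ} {lam : ℝ} {μ : Measure Ω} [IsFiniteMeasure μ] {X : ℕ → Ω → V}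
    (hX : ∀ t, Measurable (X t)) (hwalk : IsTrueSelfAvoidingWalk P lam μ X)
    {B : ℕ → Set Ω} (hB : ∀ t, MeasurableSet[past X t] (B t)) (l : V) :
    ∀ᵐ ω ∂μ, {t | ω ∈ B t ∧ X (t + 1) ω = l}.Infinite ↔
      Tendsto (fun n => ∑ t ∈ Finset.range n,
        (B t).indicator (fun ω => transition P lam (fun s => X s ω) t (X t ω) l) ω)
        atTop atTop := by
  let ℱ : Filtration ℕ m :=
    { seq := past X
      mono' := fun _ _ h => biSup_mono fun _ => ge_trans h
      le' := fun t => iSup₂_le fun s _ => (hX s).comap_le }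
  -- The step out of time `t` is only known at `t + 1`, hence the shift; `∅` is a filler.
  let A : ℕ → Set Ω := fun n => n.casesOn ∅ fun t => B t ∩ {ω | X (t + 1) ω = l}
  have hA : ∀ n, MeasurableSet[ℱ n] (A n)
    | 0 => @MeasurableSet.empty _ (ℱ 0)
    | t + 1 => @MeasurableSet.inter _ (ℱ (t + 1)) _ _ (ℱ.mono t.le_succ _ (hB t))
        (measurable_past X le_rfl (measurableSet_singleton l))
  have hcond : ∀ t, μ[(A (t + 1)).indicator (1 : Ω → ℝ) | ℱ t] =ᵐ[μ]
      (B t).indicator fun ω => transition P lam (fun s => X s ω) t (X t ω) l := fun t => by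
    have hE : MeasurableSet {ω | X (t + 1) ω = l} := hX (t + 1) (measurableSet_singleton l)
    have h1 := condExp_indicator (m := past X t)
      ((integrable_const (1 : ℝ)).indicator hE : Integrable _ μ) (hB t)
    rw [Set.indicator_indicator] at h1
    refine h1.trans ?_
    filter_upwards [hwalk t l] with ω hω
    by_cases hωB : ω ∈ B t
    · simpa only [Set.indicator_of_mem hωB] using hω
    · simp only [Set.indicator_of_notMem hωB]
  filter_upwards [ae_mem_limsup_atTop_iff μ hA, ae_all_iff.2 hcond] with ω hω hc
  simp only [hc] at hω
  rw [← hω, ← limsup_nat_add A 1, mem_limsup_iff_frequently_mem, Nat.frequently_atTop_iff_infinite]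
  rfl

/-- Almost surely, an edge `(i, k)` with `0 < P i k` is traversed infinitely often if `i` is visited
infinitely often. -/
lemma ae_infinite_edge [Fintype V] [MeasurableSingletonClass V] {m : MeasurableSpace Ω}
    {P : Matrix V V ℝ} {lam : ℝ} (hlam : 0 ≤ lam) {μ : Measure Ω} [IsFiniteMeasure μ]
    {X : ℕ → Ω → V} (hX : ∀ t, Measurable (X t)) (hwalk : IsTrueSelfAvoidingWalk P lam μ X)
    {i k : V} (hP : ∀ j, 0 ≤ P i j) (hsum : ∑ j, P i j = 1) (hk : 0 < P i k) :
    ∀ᵐ ω ∂μ, {t | X t ω = i}.Infinite → {t | X t ω = i ∧ X (t + 1) ω = k}.Infinite := by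
  have hV : ∀ t, MeasurableSet[past X t] {ω | X t ω = i} := fun t =>
    measurable_past X le_rfl (measurableSet_singleton i)
  have hB : ∀ l t, MeasurableSet[past X t] {ω | X t ω = i ∧
      edgeDiscrepancy P (fun s => X s ω) t i k ≤ edgeDiscrepancy P (fun s => X s ω) t i l} :=
    fun l t => @MeasurableSet.inter _ (past X t) _ _ (hV t)
      (@measurableSet_le _ _ _ _ _ (past X t) _ _ _ _ _
        (measurable_edgeDiscrepancy P X t i k) (measurable_edgeDiscrepancy P X t i l))
  filter_upwards [ae_infinite_step_iff hX hwalk hV k,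
    ae_all_iff.2 fun l => ae_infinite_step_iff hX hwalk (hB l) l] with ω hω hωl hi
  refine infinite_edge_of_infinite_visits hP hsum hk hi fun l hl => hω.2 ?_
  -- Dividing by the ratio `P i l / P i k` below needs it positive; if `P i l = 0`, the divergent
  -- sum would vanish.
  by_cases hl0 : P i l = 0
  · refine absurd ((hωl l).1 hl) ?_
    convert not_tendsto_const_atTop (0 : ℝ) (atTop : Filter ℕ) using 3 with n
    refine Finset.sum_eq_zero fun t _ => ?_
    by_cases hti : X t ω = i <;> simp [Set.indicator_apply, hti, transition, hl0]
  have hc : 0 < P i l / P i k := div_pos ((hP l).lt_of_ne' hl0) hk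
  refine (tendsto_const_mul_atTop_of_pos hc).1 (tendsto_atTop_mono (fun n => ?_) ((hωl l).1 hl))
  rw [Finset.mul_sum]
  refine Finset.sum_le_sum fun t _ => ?_
  simp only [Set.indicator_apply, Set.mem_ofPred_eq]
  by_cases hti : X t ω = i
  · by_cases hle : edgeDiscrepancy P (fun s => X s ω) t i k ≤
        edgeDiscrepancy P (fun s => X s ω) t i l
    · simpa [hti, hle] using transition_le_mul_transition hlam hP hk hle
    · simpa [hti, hle] using mul_nonneg hc.le (transition_nonneg hP k)
  · simp [hti]

end Walk

end TSAW

theorem mainTheorem6 {V : Type*} [Fintype V] [DecidableEq V] [Nonempty V]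
    [MeasurableSpace V] [MeasurableSingletonClass V]
    (P : Matrix V V ℝ) (hP : P ∈ Matrix.rowStochastic ℝ V) (hirr : P.IsIrreducible)
    (lam : ℝ) (hlam : 0 < lam)
    {Ω : Type*} [MeasurableSpace Ω] (μ : MeasureTheory.Measure Ω)
    [MeasureTheory.IsProbabilityMeasure μ]
    (X : ℕ → Ω → V) (hX : ∀ t, Measurable (X t))
    (hwalk : TSAW.IsTrueSelfAvoidingWalk P lam μ X) :
    ∀ᵐ ω ∂μ,
      (∀ i : V, {t : ℕ | X t ω = i}.Infinite) ∧
      (∀ i j : V, 0 < P i j → {t : ℕ | X t ω = i ∧ X (t + 1) ω = j}.Infinite) := by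
  have hP' := Matrix.mem_rowStochastic_iff_sum.1 hP
  have hedge : ∀ᵐ ω ∂μ, ∀ i j : V, 0 < P i j → {t : ℕ | X t ω = i}.Infinite →
      {t : ℕ | X t ω = i ∧ X (t + 1) ω = j}.Infinite := by
    simp only [MeasureTheory.ae_all_iff]
    exact fun i j hij => (TSAW.ae_infinite_edge hlam.le hX hwalk (hP'.1 i) (hP'.2 i) hij)
  filter_upwards [hedge] with ω hω
  have hvisit : ∀ i : V, {t : ℕ | X t ω = i}.Infinite := by
    obtain ⟨i₀, hi₀⟩ := Finite.exists_infinite_fiber fun t => X t ω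
    intro i
    let := P.toQuiver
    obtain ⟨p, -⟩ := hirr.connected i₀ i
    induction p with
    | nil => exact Set.infinite_coe_iff.1 hi₀
    | @cons b c p e ih =>
      -- Arrivals at `c`, shifted back by one, include all departures along the edge `(b, c)`.
      refine Set.Infinite.of_image (fun t => t - 1) ?_
      refine (hω b c e.down ih).mono fun t ht => ⟨t + 1, ht.2, rfl⟩
  exact ⟨hvisit, fun i j hij => hω i j hij (hvisit i)⟩
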